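/- Let $\mathcal X$ be an instance space, $\mathcal Y=\{-1,1\}$, and $\mathcal H\subseteq\mathcal Y^{\mathcal X}$ a hypothesis class of finite VC dimension $d=\mathrm{VC}(\mathcal H)$. An adversary $(\mathcal G,\mu)$ consists of a family $\mathcal G$ of perturbation functions $g:\mathcal X\to\mathcal X$ and a probability measure $\mu$ on $\mathcal G$. Let $\ell:\mathbb R\to\mathbb R$ be $L$-Lipschitz on $[-1,1]$, let $B=\max_{[-1,1]}\ell-\min_{[-1,1]}\ell\le 2L$ be the range of the loss, and put $$\ell_{\mathcal G,\mu}(h,(x,y))=\ell\big(y\,\mathbb E_{g\sim\mu}[h(g(x))]\big).$$ For a distribution $\mathcal D$ on $\mathcal X\times\mathcal Y$ write $R_{\mathcal D}(h)=\mathbb E_{\mathcal D}[\ell_{\mathcal G,\mu}(h,(x,y))]$, and for a sample $S\in(\mathcal X\times\mathcal Y)^n$ let $\hat R_S(h)$ be the average of the loss of $h$ over $S$. Assume that $(g,x)\mapsto h(g(x))$ is measurable for every $h\in\mathcal H$, and consider distributions $\mathcal D$ for which the loss class $\{\ell_{\mathcal G,\mu}(h,\cdot):h\in\mathcal H\}$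 is $\mathcal D$-measurable: for all $n$ and $e\in\mathbb R^n$ the map $(z_1,\dots,z_n)\mapsto\sup_{h\in\mathcal H}\big|\sum_i e_i\,\ell_{\mathcal G,\mu}(h,z_i)\big|$ is measurable with respect to the completion of $\mathcal D^n$ (this is automatic for countable $\mathcal H$). There is an absolute constant $C>0$ such that for all such data, all $\varepsilon,\delta\in(0,1)$ and all $n\ge 1$ with $$n\;\ge\; C\,\frac{d\,L^2\,\ln(L/\varepsilon)+B^2\ln(1/\delta)}{\varepsilon^2},$$ where each logarithm $\ln t$ is read as $\max\{1,\ln t\}$ (also for $L=0$), the following hold. 1. (Uniform convergence.) For every such $\mathcal D$, with probability at least $1-\delta$ over $S\sim\mathcal D^n$, $|R_{\mathcal D}(h)-\hat R_S(h)|\le\varepsilon$ for all $h\in\mathcal H$ simultaneously. 2. (ERM is a proper agnostic learner.) Let $\gamma\ge 0$ and let $\mathcal A$ be a learning rule with $\mathcal A(S)\in\mathcal H$ and $\hat R_S(\mathcal A(S))\le \hat R_S(h)+\gamma$ for all $h\in\mathcal H$ and all samples $S$; for $\gamma=0$ this is exact empirical risk minimisation $\mathcal A(S)\in\operatorname{argmin}_{h\in\mathcal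 H}\hat R_S(h)$. Then for every such $\mathcal D$, with probability at least $1-\delta$ over $S\sim\mathcal D^n$, $$R_{\mathcal D}(\mathcal A(S))\le\inf_{h\in\mathcal H}R_{\mathcal D}(h)+\varepsilon+\gamma .$$ For losses with range $B\le 1$ the sample size is $O\big((\mathrm{VC}(\mathcal H)L^2\ln(L/\varepsilon)+\ln(1/\delta))/\varepsilon^2\big)$. -/

import Mathlib

open MeasureTheory

namespace RobustLearning

/-- The label space `{-1, 1}`, realised as the units of `ℤ`. -/
abbrev Label : Type := ℤˣ

/-- The label as a real number, `-1` or `1`. -/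
def Label.toReal (y : Label) : ℝ := ((y : ℤ) : ℝ)

/-- The finite set `s` is shattered by `H`: every labelling of `s` is realised by some `h ∈ H`. -/
def Shatters {X : Type*} (H : Set (X → Label)) (s : Finset X) : Prop :=
  ∀ y : X → Label, ∃ h ∈ H, ∀ x ∈ s, h x = y x

/-- The VC dimension: the largest size of a shattered finite set, `⊤` if there is no largest one. -/
noncomputable def vcDim {X : Type*} (H : Set (X → Label)) : ℕ∞ :=
  ⨆ (s : Finset X) (_ : Shatters H s), (s.card : ℕ∞)

/-- `E_{g ∼ μ}[h(g(x))]`, where `act g : X → X` is the perturbation function with index `g`. -/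
noncomputable def smoothed {X G : Type*} [MeasurableSpace G] (act : G → X → X) (μ : Measure G)
    (h : X → Label) (x : X) : ℝ :=
  ∫ g, (h (act g x)).toReal ∂μ

/-- The loss `ℓ(y E_{g ∼ μ}[h(g(x))])` of the hypothesis `h` on the example `z = (x, y)`. -/
noncomputable def robustLoss {X G : Type*} [MeasurableSpace G] (ℓ : ℝ → ℝ) (act : G → X → X)
    (μ : Measure G) (h : X → Label) (z : X × Label) : ℝ :=
  ℓ (z.2.toReal * smoothed act μ h z.1)

/-- The population risk `E_D[loss(h, (x, y))]`. -/
noncomputable def risk {X : Type*} [MeasurableSpace X] (loss : (X → Label) → X × Label → ℝ)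
    (D : Measure (X × Label)) (h : X → Label) : ℝ :=
  ∫ z, loss h z ∂D

/-- The empirical risk of `h` on the sample `S`. -/
noncomputable def empRisk {X : Type*} (loss : (X → Label) → X × Label → ℝ) {n : ℕ}
    (S : Fin n → X × Label) (h : X → Label) : ℝ :=
  (∑ i, loss h (S i)) / n

/-- The law `D^n` of an i.i.d. sample of size `n`. -/
noncomputable def sampleLaw {Z : Type*} [MeasurableSpace Z] (D : Measure Z) (n : ℕ) :
    Measure (Fin n → Z) :=
  Measure.pi fun _ => D

/-- `A` is a proper learning rule that minimises the empirical risk over `H` up to the tolerance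
`γ`. For `γ = 0` this is exact empirical risk minimisation, `A(S) ∈ argmin_{h ∈ H}`. -/
def IsERM {X : Type*} (loss : (X → Label) → X × Label → ℝ) (H : Set (X → Label)) (γ : ℝ)
    (A : (n : ℕ) → (Fin n → X × Label) → (X → Label)) : Prop :=
  ∀ (n : ℕ) (S : Fin n → X × Label),
    A n S ∈ H ∧ ∀ h ∈ H, empRisk loss S (A n S) ≤ empRisk loss S h + γ

/-- `F` is a `D`-measurable class of functions in the usual sense of empirical process theory: the
suprema `sup_{f ∈ F} |∑ i, e i * f (z i)|` are measurable for the completion of `D^n`.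
Every countable class of measurable functions has this property. -/
def IsMeasurableClass {Z : Type*} [MeasurableSpace Z] (D : Measure Z) (F : Set (Z → ℝ)) : Prop :=
  ∀ (n : ℕ) (e : Fin n → ℝ),
    AEMeasurable (fun S : Fin n → Z => ⨆ f : F, |∑ i, e i * (f : Z → ℝ) (S i)|) (sampleLaw D n)

/-- The natural logarithm, read as at least `1`. -/
noncomputable def logOne (t : ℝ) : ℝ := max 1 (Real.log t)

/-- The oscillation of `ℓ` on the range `[-1, 1]` of the margin. -/
noncomputable def lossRange (ℓ : ℝ → ℝ) : ℝ := Metric.diam (ℓ '' Set.Icc (-1) 1)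

/-- The sample size, up to an absolute constant factor. -/
noncomputable def sampleBound (d : ℕ) (L B ε δ : ℝ) : ℝ :=
  (d * L ^ 2 * logOne (L / ε) + B ^ 2 * logOne (1 / δ)) / ε ^ 2

end RobustLearning

open RobustLearning

namespace RobustLearning

/-! Smoothing does not increase Rademacher complexity. The supremum over `h` of a signed sum of the
averages `E_g[h(g(x_i))]` is at most the `μ`-average of the suprema for fixed `g`. For fixed `g` the
points `g(x_i)` are just another `n`-tuple, on which `H` cuts out few patterns (Sauer–Shelah), so
Massart's finite-class bound applies uniformly in `g`: this is `sum_iSup_corr_smoothed_le`. The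
contraction principle `sum_iSup_corr_le_of_contraction` then carries the bound to the loss at the
price of a factor `L`.

To pass to a high-probability statement, the population risk is replaced by the empirical risk of a
ghost sample (`sampleLaw_exists_lt_abs_le`), and exchanging paired examples at random reduces the
two-sample deviation, with both samples held fixed, to a count of sign vectors
(`prod_exists_lt_abs_sum_sub_le`). McDiarmid's inequality on the hypercube bounds that count around
the Rademacher average. Its fluctuations depend on the range `B` and its mean on `L` and `d`, which
is why `B ^ 2` multiplies only the confidence term.

The ERM guarantee is uniform convergence at accuracy `ε / 2`, used once for the output and once for
a competitor. -/

lemma Label.toReal_one : Label.toReal 1 = 1 := by simp [Label.toReal]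

lemma Label.toReal_neg (y : Label) : Label.toReal (-y) = -Label.toReal y := by
  simp [Label.toReal]

lemma Label.toReal_eq (y : Label) : Label.toReal y = 1 ∨ Label.toReal y = -1 := by
  rcases Int.units_eq_one_or y with rfl | rfl
  · exact Or.inl Label.toReal_one
  · right; rw [Label.toReal_neg, Label.toReal_one]

lemma Label.abs_toReal (y : Label) : |Label.toReal y| = 1 := by
  rcases y.toReal_eq with h | h <;> simp [h]

lemma sum_label {M : Type*} [AddCommMonoid M] (f : Label → M) : ∑ s, f s = f 1 + f (-1) := by
  have : (Finset.univ : Finset Label) = {1, -1} := rfl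
  rw [this, Finset.sum_pair (by decide)]

/-! ### Sign vectors and their correlations -/

/-- Sign vectors of length `n`. -/
abbrev Signs (n : ℕ) : Type := Fin n → Label

lemma card_signs (n : ℕ) : Fintype.card (Signs n) = 2 ^ n := by
  simp [Signs]

lemma sum_signs_succ {n : ℕ} (f : Signs (n + 1) → ℝ) :
    ∑ σ, f σ = ∑ σ : Signs n, (f (Fin.cons 1 σ) + f (Fin.cons (-1) σ)) := by
  rw [← (Fin.consEquiv fun _ : Fin (n + 1) => Label).sum_comp f, Fintype.sum_prod_type, sum_label,
    ← Finset.sum_add_distrib]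
  rfl

/-- The correlation of a sign vector with a real vector. -/
noncomputable def corr {n : ℕ} (σ : Signs n) (a : Fin n → ℝ) : ℝ := ∑ i, (σ i).toReal * a i

lemma corr_cons {n : ℕ} (s : Label) (σ : Signs n) (a : Fin (n + 1) → ℝ) :
    corr (Fin.cons s σ : Signs (n + 1)) a = s.toReal * a 0 + corr σ (fun i => a i.succ) := by
  simp [corr, Fin.sum_univ_succ]

lemma corr_neg {n : ℕ} (σ : Signs n) (a : Fin n → ℝ) : corr (-σ) a = -corr σ a := by
  simp [corr, Label.toReal_neg]

lemma corr_sub {n : ℕ} (σ : Signs n) (a b : Fin n → ℝ) :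
    corr σ (fun i => a i - b i) = corr σ a - corr σ b := by
  simp [corr, mul_sub]

lemma corr_update {n : ℕ} (σ : Signs n) (i : Fin n) (s : Label) (a : Fin n → ℝ) :
    corr (Function.update σ i s) a = corr σ a + (s.toReal - (σ i).toReal) * a i := by
  have h : ∀ j, (Function.update σ i s j).toReal * a j
      = (σ j).toReal * a j + if j = i then (s.toReal - (σ i).toReal) * a i else 0 := by
    intro j
    rcases eq_or_ne j i with rfl | h
    · simp; ring
    · simp [h]
  simp only [corr, h, Finset.sum_add_distrib]
  simp

lemma abs_corr_le {n : ℕ} (σ : Signs n) {a : Fin n → ℝ} {M : ℝ} (ha : ∀ i, |a i| ≤ M) :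
    |corr σ a| ≤ n * M := by
  calc |corr σ a| ≤ ∑ i, |(σ i).toReal * a i| := Finset.abs_sum_le_sum_abs _ _
    _ ≤ ∑ _i : Fin n, M := Finset.sum_le_sum fun i _ => by
        rw [abs_mul, Label.abs_toReal, one_mul]; exact ha i
    _ = n * M := by simp

/-! ### Concentration on the hypercube -/

/-- **McDiarmid's inequality** on the hypercube, as a bound on the moment generating function. -/
lemma sum_exp_le_of_bounded_differences {n : ℕ} (V : Signs n → ℝ) {c : ℝ}
    (hV : ∀ σ i s, V (Function.update σ i s) - V σ ≤ c) (t : ℝ) :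
    ∑ σ, Real.exp (t * V σ)
      ≤ 2 ^ n * Real.exp (t * ((∑ σ, V σ) / 2 ^ n) + n * (t * c) ^ 2 / 8) := by
  induction n generalizing c with
  | zero => simp
  | succ n ih =>
    -- Averaging out the first sign preserves both the mean and the bound `c` on the differences, so
    -- induction applies to `W`.
    set W : Signs n → ℝ := fun σ => (V (Fin.cons 1 σ) + V (Fin.cons (-1) σ)) / 2 with hW
    have hWd : ∀ σ i s, W (Function.update σ i s) - W σ ≤ c := by
      intro σ i s
      have h1 := hV (Fin.cons 1 σ) i.succ s
      have h2 := hV (Fin.cons (-1) σ) i.succ s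
      rw [← Fin.cons_update] at h1 h2
      simp only [hW]
      linarith
    have hsum : ∑ σ, V σ = 2 * ∑ σ, W σ := by
      rw [sum_signs_succ, Finset.mul_sum]
      refine Finset.sum_congr rfl fun σ _ => ?_
      simp only [hW]; ring
    have hpt : ∀ σ : Signs n, Real.exp (t * V (Fin.cons 1 σ)) + Real.exp (t * V (Fin.cons (-1) σ))
        ≤ 2 * Real.exp ((t * c) ^ 2 / 8) * Real.exp (t * W σ) := by
      intro σ
      have h1 := hV (Fin.cons 1 σ) 0 (-1)
      have h2 := hV (Fin.cons (-1) σ) 0 1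
      rw [Fin.update_cons_zero] at h1 h2
      set x := V (Fin.cons 1 σ)
      set y := V (Fin.cons (-1) σ)
      -- The one-sided hypothesis, used at both values of the sign, bounds the difference in both
      -- directions.
      have hxy : |x - y| ≤ c := abs_le.2 ⟨by linarith, by linarith⟩
      have hcosh := Real.cosh_le_exp_half_sq (t * (x - y) / 2)
      have hsq : (t * (x - y) / 2) ^ 2 / 2 ≤ (t * c) ^ 2 / 8 := by
        have : (x - y) ^ 2 ≤ c ^ 2 := sq_le_sq' (by linarith [abs_le.1 hxy]) (abs_le.1 hxy).2
        nlinarith [mul_le_mul_of_nonneg_left this (sq_nonneg t)]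
      have he : Real.exp (t * x) + Real.exp (t * y)
          = 2 * Real.cosh (t * (x - y) / 2) * Real.exp (t * W σ) := by
        change _ = _ * Real.exp (t * ((x + y) / 2))
        rw [Real.cosh_eq]
        have e1 : t * x = t * (x - y) / 2 + t * ((x + y) / 2) := by ring
        have e2 : t * y = -(t * (x - y) / 2) + t * ((x + y) / 2) := by ring
        rw [e1, Real.exp_add, e2, Real.exp_add]
        ring
      rw [he]
      gcongr
      exact hcosh.trans (Real.exp_le_exp.2 hsq)
    rw [sum_signs_succ, hsum]
    calc _ ≤ ∑ σ : Signs n, 2 * Real.exp ((t * c) ^ 2 / 8) * Real.exp (t * W σ) :=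
          Finset.sum_le_sum fun σ _ => hpt σ
      _ = 2 * Real.exp ((t * c) ^ 2 / 8) * ∑ σ : Signs n, Real.exp (t * W σ) := by
          rw [Finset.mul_sum]
      _ ≤ 2 * Real.exp ((t * c) ^ 2 / 8)
          * (2 ^ n * Real.exp (t * ((∑ σ, W σ) / 2 ^ n) + n * (t * c) ^ 2 / 8)) := by
          gcongr; exact ih W hWd
      _ = 2 ^ (n + 1) * (Real.exp ((t * c) ^ 2 / 8)
          * Real.exp (t * ((∑ σ, W σ) / 2 ^ n) + n * (t * c) ^ 2 / 8)) := by ring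
      _ = _ := by
          rw [← Real.exp_add]
          congr 2
          push_cast
          field_simp
          ring

/-- **McDiarmid's inequality** on the hypercube. -/
lemma card_signs_le_of_bounded_differences {n : ℕ} (V : Signs n → ℝ) {c : ℝ}
    (hV : ∀ σ i s, V (Function.update σ i s) - V σ ≤ c) {t m : ℝ} (ht : 0 ≤ t)
    (hm : ∑ σ, V σ ≤ 2 ^ n * m) (u : ℝ) [DecidablePred fun σ => u < V σ] :
    ((Finset.univ.filter fun σ => u < V σ).card : ℝ)
      ≤ 2 ^ n * Real.exp (t * (m - u) + n * (t * c) ^ 2 / 8) := by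
  have h := sum_exp_le_of_bounded_differences V hV t
  have h1 : ((Finset.univ.filter fun σ => u < V σ).card : ℝ) * Real.exp (t * u)
      ≤ ∑ σ, Real.exp (t * V σ) := by
    calc _ = ∑ σ ∈ Finset.univ.filter (fun σ => u < V σ), Real.exp (t * u) := by simp
      _ ≤ ∑ σ ∈ Finset.univ.filter (fun σ => u < V σ), Real.exp (t * V σ) :=
          Finset.sum_le_sum fun σ hσ => by
            have := (Finset.mem_filter.1 hσ).2
            gcongr
      _ ≤ _ := Finset.sum_le_sum_of_subset_of_nonneg (Finset.filter_subset _ _)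
          fun _ _ _ => (Real.exp_pos _).le
  have h2 : (∑ σ, V σ) / 2 ^ n ≤ m := by
    rw [div_le_iff₀ (by positivity)]; linarith
  have h3 : ((Finset.univ.filter fun σ => u < V σ).card : ℝ) * Real.exp (t * u)
      ≤ 2 ^ n * Real.exp (t * (m - u) + n * (t * c) ^ 2 / 8) * Real.exp (t * u) := by
    rw [mul_assoc, ← Real.exp_add]
    refine h1.trans (h.trans ?_)
    refine mul_le_mul_of_nonneg_left (Real.exp_le_exp.2 ?_) (by positivity)
    linarith [mul_le_mul_of_nonneg_left h2 ht]
  exact le_of_mul_le_mul_right h3 (Real.exp_pos _)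

/-! ### Rademacher averages: contraction and finite classes -/

lemma bddAbove_range_of_abs_le {ι : Type*} {f : ι → ℝ} {M : ℝ} (h : ∀ i, |f i| ≤ M) :
    BddAbove (Set.range f) :=
  ⟨M, by rintro _ ⟨i, rfl⟩; exact (le_abs_self _).trans (h i)⟩

lemma bddAbove_range_corr {ι : Type*} {n : ℕ} (σ : Signs n) {a : ι → Fin n → ℝ} {M : ℝ}
    (ha : ∀ h i, |a h i| ≤ M) : BddAbove (Set.range fun h => corr σ (a h)) :=
  bddAbove_range_of_abs_le fun h => abs_corr_le σ (ha h)

/-- The offset `u` makes the induction possible: it holds the signed head coordinate while the tail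
is contracted. The bounds `M` and `N` only keep the suprema finite and do not enter the conclusion.
-/
lemma sum_iSup_add_corr_le {ι : Type*} [Nonempty ι] {n : ℕ} {M : ℝ} (a b : ι → Fin n → ℝ)
    (ha : ∀ h i, |a h i| ≤ M) (hb : ∀ h i, |b h i| ≤ M)
    (hab : ∀ h h' i, |a h i - a h' i| ≤ |b h i - b h' i|) {N : ℝ} (u : ι → ℝ)
    (hu : ∀ h, |u h| ≤ N) :
    ∑ σ, ⨆ h, (u h + corr σ (a h)) ≤ ∑ σ, ⨆ h, (u h + corr σ (b h)) := by
  induction n generalizing u N with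
  | zero => simp [corr]
  | succ n ih =>
    set a' : ι → Fin n → ℝ := fun h i => a h i.succ
    set b' : ι → Fin n → ℝ := fun h i => b h i.succ
    have hua : ∀ (s : Label) h, |u h + s.toReal * a h 0| ≤ N + M := fun s h =>
      (abs_add_le _ _).trans (add_le_add (hu h)
        (by rw [abs_mul, Label.abs_toReal, one_mul]; exact ha h 0))
    have hub : ∀ (s : Label) h, |u h + s.toReal * b h 0| ≤ N + M := fun s h =>
      (abs_add_le _ _).trans (add_le_add (hu h)
        (by rw [abs_mul, Label.abs_toReal, one_mul]; exact hb h 0))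
    have hcons : ∀ (c : ι → Fin (n + 1) → ℝ) (s : Label) (σ : Signs n),
        (⨆ h, (u h + corr (Fin.cons s σ : Signs (n + 1)) (c h)))
          = ⨆ h, ((u h + s.toReal * c h 0) + corr σ (fun i => c h i.succ)) := by
      intro c s σ
      congr 1; ext h
      rw [corr_cons]; ring
    have hbdd : ∀ (s : Label) (σ : Signs n),
        BddAbove (Set.range fun h => (u h + s.toReal * b h 0) + corr σ (b' h)) := fun s σ =>
      bddAbove_range_of_abs_le (M := N + M + n * M) fun h =>
        (abs_add_le _ _).trans (add_le_add (hub s h) (abs_corr_le σ fun i => hb h i.succ))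
    rw [sum_signs_succ, sum_signs_succ]
    simp only [hcons]
    rw [Finset.sum_add_distrib]
    have hstep : ∀ s : Label,
        ∑ σ : Signs n, ⨆ h, ((u h + s.toReal * a h 0) + corr σ (a' h))
          ≤ ∑ σ : Signs n, ⨆ h, ((u h + s.toReal * a h 0) + corr σ (b' h)) := fun s =>
      ih a' b' (fun h i => ha h _) (fun h i => hb h _) (fun h h' i => hab h h' _) _ (hua s)
    refine (add_le_add (hstep 1) (hstep (-1))).trans ?_
    rw [← Finset.sum_add_distrib]
    refine Finset.sum_le_sum fun σ _ => ?_
    simp only [Label.toReal_neg, Label.toReal_one]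
    have B1 := hbdd 1 σ
    have B2 := hbdd (-1) σ
    simp only [Label.toReal_neg, Label.toReal_one] at B1 B2
    -- Summed over both signs, the head contributes only `a h 0 - a h' 0`, at most `|b h 0 - b h'
    -- 0|`. Depending on the sign of `b h 0 - b h' 0`, the pair `(h, h')` or `(h', h)` realises this
    -- bound on the right.
    refine ciSup_add_ciSup_le fun h h' => ?_
    have hk := abs_le.1 (hab h h' 0)
    have l1 := le_ciSup B1 h
    have l2 := le_ciSup B2 h'
    have l3 := le_ciSup B1 h'
    have l4 := le_ciSup B2 h
    rcases le_total 0 (b h 0 - b h' 0) with hs | hs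
    · rw [abs_of_nonneg hs] at hk
      linarith
    · rw [abs_of_nonpos hs] at hk
      linarith

/-- The **Ledoux–Talagrand contraction principle** for Rademacher averages. -/
lemma sum_iSup_corr_le_of_contraction {ι : Type*} [Nonempty ι] {n : ℕ} {M : ℝ}
    (a b : ι → Fin n → ℝ) (ha : ∀ h i, |a h i| ≤ M) (hb : ∀ h i, |b h i| ≤ M)
    (hab : ∀ h h' i, |a h i - a h' i| ≤ |b h i - b h' i|) :
    ∑ σ, ⨆ h, corr σ (a h) ≤ ∑ σ, ⨆ h, corr σ (b h) := by
  simpa using sum_iSup_add_corr_le a b ha hb hab (N := 0) (fun _ => 0) (by simp)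

/-- The sum factorises over coordinates, and since `cosh` is even the fixed pattern `p` drops out.
-/
lemma sum_exp_corr {n : ℕ} (t : ℝ) (p : Signs n) :
    ∑ σ, Real.exp (t * corr σ fun i => (p i).toReal) = (2 * Real.cosh t) ^ n := by
  have h : ∀ σ : Signs n, Real.exp (t * corr σ fun i => (p i).toReal)
      = ∏ i, Real.exp (t * ((σ i).toReal * (p i).toReal)) := by
    intro σ
    rw [← Real.exp_sum, corr, Finset.mul_sum]
  simp only [h]
  have h2 := Finset.prod_univ_sum (fun _ : Fin n => (Finset.univ : Finset Label))
    (fun i s => Real.exp (t * (s.toReal * (p i).toReal)))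
  rw [Fintype.piFinset_univ] at h2
  rw [← h2]
  have h3 : ∀ i, ∑ s : Label, Real.exp (t * (s.toReal * (p i).toReal)) = 2 * Real.cosh t := by
    intro i
    rw [sum_label, Real.cosh_eq]
    rcases (p i).toReal_eq with h | h <;> simp [h, Label.toReal_neg, Label.toReal_one] <;> ring
  simp only [h3, Finset.prod_const, Finset.card_univ, Fintype.card_fin]

/-- **Massart's lemma** for finitely many sign patterns. -/
lemma sum_iSup_corr_le_of_card_patterns {ι : Type*} [Nonempty ι] {n : ℕ} (p : ι → Signs n)
    (P : Finset (Signs n)) (hp : ∀ h, p h ∈ P) {K : ℝ} (hK : (P.card : ℝ) ≤ Real.exp K)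
    {t : ℝ} (ht : 0 < t) :
    ∑ σ, ⨆ h, corr σ (fun i => (p h i).toReal) ≤ 2 ^ n * (K / t + n * t / 2) := by
  set V : Signs n → ℝ := fun σ => ⨆ h, corr σ (fun i => (p h i).toReal) with hV
  have hbdd : ∀ σ, BddAbove (Set.range fun h => corr σ (fun i => (p h i).toReal)) := fun σ =>
    bddAbove_range_corr σ (M := 1) fun h i => (Label.abs_toReal _).le
  have hVle : ∀ σ, Real.exp (t * V σ)
      ≤ ∑ q ∈ P, Real.exp (t * corr σ fun i => (q i).toReal) := by
    intro σ
    have hpos : ∃ h : ι, Real.exp (t * corr σ fun i => (p h i).toReal) ≤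
        ∑ q ∈ P, Real.exp (t * corr σ fun i => (q i).toReal) := ⟨Classical.arbitrary ι,
      Finset.single_le_sum (f := fun q : Signs n => Real.exp (t * corr σ fun i => (q i).toReal))
        (fun _ _ => (Real.exp_pos _).le) (hp _)⟩
    have hS : 0 < ∑ q ∈ P, Real.exp (t * corr σ fun i => (q i).toReal) := by
      obtain ⟨h, hh⟩ := hpos
      exact (Real.exp_pos _).trans_le hh
    rw [← Real.le_log_iff_exp_le hS, ← le_div_iff₀' ht]
    refine ciSup_le fun h => ?_
    rw [le_div_iff₀' ht, Real.le_log_iff_exp_le hS]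
    exact Finset.single_le_sum
      (f := fun q : Signs n => Real.exp (t * corr σ fun i => (q i).toReal))
      (fun _ _ => (Real.exp_pos _).le) (hp _)
  have hsum : ∑ σ, Real.exp (t * V σ) ≤ 2 ^ n * Real.exp (K + n * t ^ 2 / 2) := by
    calc _ ≤ ∑ σ, ∑ q ∈ P, Real.exp (t * corr σ fun i => (q i).toReal) :=
          Finset.sum_le_sum fun σ _ => hVle σ
      _ = ∑ q ∈ P, (2 * Real.cosh t) ^ n := by
          rw [Finset.sum_comm]
          exact Finset.sum_congr rfl fun q _ => sum_exp_corr t q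
      _ = P.card * (2 * Real.cosh t) ^ n := by simp
      _ ≤ Real.exp K * (2 * Real.exp (t ^ 2 / 2)) ^ n := by
          have := Real.cosh_pos t
          gcongr
          exact Real.cosh_le_exp_half_sq t
      _ = _ := by
          rw [mul_pow, ← Real.exp_nat_mul, Real.exp_add]; ring_nf
  -- This replaces Jensen's inequality: the tangent to `exp` at the target exponent lies below the
  -- graph, so summing it bounds the mean of `t * V`.
  have hlin : ∀ σ, Real.exp (K + n * t ^ 2 / 2) * (1 + (t * V σ - (K + n * t ^ 2 / 2)))
      ≤ Real.exp (t * V σ) := by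
    intro σ
    have := Real.add_one_le_exp (t * V σ - (K + n * t ^ 2 / 2))
    calc _ ≤ Real.exp (K + n * t ^ 2 / 2) * Real.exp (t * V σ - (K + n * t ^ 2 / 2)) := by
          gcongr; linarith
      _ = _ := by rw [← Real.exp_add]; congr 1; ring
  have hfin := (Finset.sum_le_sum fun σ (_ : σ ∈ Finset.univ) => hlin σ).trans hsum
  rw [← Finset.mul_sum, mul_comm ((2 : ℝ) ^ n)] at hfin
  have h4 := le_of_mul_le_mul_left hfin (Real.exp_pos _)
  have hcard : (Fintype.card (Signs n) : ℝ) = 2 ^ n := by exact_mod_cast card_signs n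
  rw [Finset.sum_add_distrib, Finset.sum_sub_distrib, ← Finset.mul_sum] at h4
  simp only [Finset.sum_const, Finset.card_univ, nsmul_eq_mul, hcard] at h4
  have h5 : t * ∑ σ, V σ ≤ 2 ^ n * (K + n * t ^ 2 / 2) := by linarith
  have h6 : 2 ^ n * (K / t + n * t / 2) = (2 ^ n * (K + n * t ^ 2 / 2)) / t := by
    field_simp
  rw [h6, le_div_iff₀' ht]
  exact h5

/-! ### Growth function and Sauer–Shelah -/

/-- The growth function bound following from the Sauer–Shelah lemma. -/
lemma sum_choose_le_exp {n d : ℕ} (hd : 1 ≤ d) (hdn : d ≤ n) :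
    ((∑ k ∈ Finset.Iic d, n.choose k : ℕ) : ℝ) ≤ Real.exp (d * (1 + Real.log (n / d))) := by
  have hd0 : (0 : ℝ) < d := by exact_mod_cast hd
  have hn0 : (0 : ℝ) < n := hd0.trans_le (by exact_mod_cast hdn)
  have hx1 : (d : ℝ) / n ≤ 1 := (div_le_one hn0).2 (by exact_mod_cast hdn)
  have hx0 : (0 : ℝ) < d / n := by positivity
  -- Since `d / n ≤ 1`, the weight `(d / n) ^ d` is at most `(d / n) ^ k` for `k ≤ d`; the weighted
  -- sum is then part of the binomial expansion of `(1 + d / n) ^ n`.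
  have key : ((d : ℝ) / n) ^ d * ((∑ k ∈ Finset.Iic d, n.choose k : ℕ) : ℝ) ≤ Real.exp d := by
    calc _ = ∑ k ∈ Finset.Iic d, ((d : ℝ) / n) ^ d * (n.choose k : ℝ) := by
          push_cast; rw [Finset.mul_sum]
      _ ≤ ∑ k ∈ Finset.Iic d, ((d : ℝ) / n) ^ k * (n.choose k : ℝ) := by
          refine Finset.sum_le_sum fun k hk => ?_
          gcongr ?_ * _
          exact pow_le_pow_of_le_one hx0.le hx1 (Finset.mem_Iic.1 hk)
      _ ≤ ∑ k ∈ Finset.range (n + 1), ((d : ℝ) / n) ^ k * (n.choose k : ℝ) := by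
          refine Finset.sum_le_sum_of_subset_of_nonneg ?_ fun _ _ _ => by positivity
          intro k hk
          have := Finset.mem_Iic.1 hk
          simp; omega
      _ = ((d : ℝ) / n + 1) ^ n := by rw [add_pow]; simp
      _ ≤ Real.exp ((d : ℝ) / n) ^ n := by
          gcongr; exact Real.add_one_le_exp _
      _ = Real.exp d := by
          rw [← Real.exp_nat_mul]; congr 1; field_simp
  have h2 : ((d : ℝ) / n) ^ d * Real.exp (d * (1 + Real.log (n / d))) = Real.exp d := by
    rw [mul_add, Real.exp_add, mul_one, Real.exp_nat_mul (Real.log _),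
      Real.exp_log (by positivity)]
    rw [mul_comm (Real.exp _), ← mul_assoc, ← mul_pow]
    have : (d : ℝ) / n * (n / d) = 1 := by field_simp
    rw [this]; simp
  rw [← h2] at key
  exact le_of_mul_le_mul_left key (by positivity)

lemma card_le_of_shatters {X : Type*} {H : Set (X → Label)} {d : ℕ} (hd : vcDim H = d)
    {s : Finset X} (hs : Shatters H s) : s.card ≤ d := by
  have : (s.card : ℕ∞) ≤ vcDim H := le_iSup₂_of_le s hs le_rfl
  rw [hd] at this
  exact_mod_cast this

open Classical in
/-- The sign patterns cut out by `H` on the points `x`. -/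
noncomputable def patterns {X : Type*} (H : Set (X → Label)) {n : ℕ} (x : Fin n → X) :
    Finset (Signs n) :=
  Finset.univ.filter fun p => ∃ h ∈ H, p = fun i => h (x i)

lemma mem_patterns {X : Type*} {H : Set (X → Label)} {n : ℕ} (x : Fin n → X) {h : X → Label}
    (hh : h ∈ H) : (fun i => h (x i)) ∈ patterns H x := by
  simp only [patterns, Finset.mem_filter, Finset.mem_univ, true_and]
  exact ⟨h, hh, rfl⟩

open Classical in
/-- The **Sauer–Shelah lemma** for the patterns of a class of finite VC dimension. -/
lemma card_patterns_le {X : Type*} {H : Set (X → Label)} {d : ℕ} (hd : vcDim H = d) {n : ℕ}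
    (x : Fin n → X) : (patterns H x).card ≤ ∑ k ∈ Finset.Iic d, n.choose k := by
  set φ : Signs n → Finset (Fin n) := fun p => Finset.univ.filter fun i => p i = 1 with hφ
  have hinj : Function.Injective φ := by
    intro p q hpq
    ext1 i
    have h : i ∈ φ p ↔ i ∈ φ q := by rw [hpq]
    simp only [hφ, Finset.mem_filter, Finset.mem_univ, true_and] at h
    rcases Int.units_eq_one_or (p i) with h1 | h1 <;> rcases Int.units_eq_one_or (q i) with h2 | h2 <;>
      simp_all
  set 𝒜 := (patterns H x).image φ
  have hvc : 𝒜.vcDim ≤ d := by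
    refine Finset.sup_le fun T hT => ?_
    rw [Finset.mem_shatterer] at hT
    -- Two indices carrying the same point receive the same label from every hypothesis, so a
    -- shattered index set cannot contain both.
    have hx : Set.InjOn x (T : Set (Fin n)) := by
      intro i hi j hj hij
      by_contra hne
      obtain ⟨u, hu, hTu⟩ := hT.exists_inter_eq_singleton hi
      obtain ⟨p, hp, rfl⟩ := Finset.mem_image.1 hu
      simp only [patterns, Finset.mem_filter, Finset.mem_univ, true_and] at hp
      obtain ⟨h, -, rfl⟩ := hp
      have hi' : i ∈ T ∩ φ (fun i => h (x i)) := by rw [hTu]; simp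
      have hj' : j ∉ T ∩ φ (fun i => h (x i)) := by rw [hTu]; simpa using Ne.symm hne
      simp only [hφ, Finset.mem_inter, Finset.mem_filter, Finset.mem_univ, true_and] at hi' hj'
      exact hj' ⟨hj, by rw [← hij]; exact hi'.2⟩
    have hsh : Shatters H (T.image x) := by
      intro y
      obtain ⟨u, hu, hTu⟩ := hT (Finset.filter_subset (fun i => y (x i) = 1) T)
      obtain ⟨p, hp, rfl⟩ := Finset.mem_image.1 hu
      simp only [patterns, Finset.mem_filter, Finset.mem_univ, true_and] at hp
      obtain ⟨h, hh, rfl⟩ := hp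
      refine ⟨h, hh, fun z hz => ?_⟩
      obtain ⟨i, hi, rfl⟩ := Finset.mem_image.1 hz
      have hiff : i ∈ T ∩ φ (fun i => h (x i)) ↔ i ∈ T.filter (fun i => y (x i) = 1) := by
        rw [hTu]
      simp only [hφ, Finset.mem_inter, Finset.mem_filter, Finset.mem_univ, true_and, hi] at hiff
      rcases Int.units_eq_one_or (h (x i)) with h1 | h1 <;>
        rcases Int.units_eq_one_or (y (x i)) with h2 | h2 <;> simp_all
    rw [← Finset.card_image_of_injOn hx]
    exact card_le_of_shatters hd hsh
  calc (patterns H x).card = 𝒜.card := (Finset.card_image_of_injective _ hinj).symm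
    _ ≤ 𝒜.shatterer.card := Finset.card_le_card_shatterer 𝒜
    _ ≤ ∑ k ∈ Finset.Iic 𝒜.vcDim, (Fintype.card (Fin n)).choose k :=
        Finset.card_shatterer_le_sum_vcDim
    _ ≤ ∑ k ∈ Finset.Iic d, n.choose k := by
        rw [Fintype.card_fin]
        exact Finset.sum_le_sum_of_subset (Finset.Iic_subset_Iic.2 hvc)

/-- The growth function of a class of VC dimension `d` on `n ≥ d` points. -/
lemma card_patterns_le_exp {X : Type*} {H : Set (X → Label)} {d : ℕ} (hd : vcDim H = d) {n : ℕ}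
    (hdn : d ≤ n) (x : Fin n → X) :
    ((patterns H x).card : ℝ) ≤ Real.exp (d * (1 + Real.log (n / d))) := by
  have h : ((patterns H x).card : ℝ) ≤ ((∑ k ∈ Finset.Iic d, n.choose k : ℕ) : ℝ) := by
    exact_mod_cast card_patterns_le hd x
  -- For `d = 0` the binomial sum is `1`, and the exponent is `0` whatever value `n / 0` takes.
  rcases Nat.eq_zero_or_pos d with rfl | hd0
  · have h0 : Finset.Iic 0 = ({0} : Finset ℕ) := rfl
    simpa [h0] using h
  · exact h.trans (sum_choose_le_exp hd0 hdn)

/-! ### Rademacher average of the smoothed class -/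

lemma Label.measurable_toReal : Measurable Label.toReal :=
  (measurable_from_top (f := fun k : ℤ => (k : ℝ))).comp (comap_measurable (Units.val : ℤˣ → ℤ))

section Smoothed

variable {X G : Type*} [MeasurableSpace G] {act : G → X → X} {μ : Measure G}

lemma abs_smoothed_le [IsProbabilityMeasure μ] (h : X → Label) (x : X) :
    |smoothed act μ h x| ≤ 1 := by
  have := norm_integral_le_of_norm_le_const (μ := μ) (C := 1)
    (f := fun g => (h (act g x)).toReal) (Filter.Eventually.of_forall fun g => by
      rw [Real.norm_eq_abs, Label.abs_toReal])
  simpa [smoothed] using this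

lemma mul_smoothed_mem_Icc [IsProbabilityMeasure μ] (h : X → Label) (z : X × Label) :
    z.2.toReal * smoothed act μ h z.1 ∈ Set.Icc (-1 : ℝ) 1 := by
  rw [Set.mem_Icc, ← abs_le, abs_mul, Label.abs_toReal, one_mul]
  exact abs_smoothed_le h z.1

lemma integrable_toReal_act [IsProbabilityMeasure μ] {h : X → Label} {x : X}
    (hm : Measurable fun g => h (act g x)) : Integrable (fun g => (h (act g x)).toReal) μ :=
  Integrable.of_bound (Label.measurable_toReal.comp hm).aestronglyMeasurable 1
    (Filter.Eventually.of_forall fun g => by rw [Real.norm_eq_abs, Label.abs_toReal])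

/-- The Rademacher average of the smoothed class is bounded by the one of a class of VC dimension
`d`, without any measurability of the suprema. -/
lemma sum_iSup_corr_smoothed_le [IsProbabilityMeasure μ] {H : Set (X → Label)} (hne : H.Nonempty)
    (hm : ∀ h ∈ H, ∀ x, Measurable fun g => h (act g x)) {d : ℕ} (hd : vcDim H = d) {n : ℕ}
    (hdn : d ≤ n) {t : ℝ} (ht : 0 < t) (x : Fin n → X) :
    ∑ σ, ⨆ h : H, corr σ (fun i => smoothed act μ h (x i))
      ≤ 2 ^ n * (d * (1 + Real.log (n / d)) / t + n * t / 2) := by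
  have : Nonempty H := hne.to_subtype
  refine le_of_forall_pos_le_add fun η hη => ?_
  -- One near-maximiser per sign vector: only finitely many hypotheses are integrated over `g`, so
  -- the supremum need not be measurable in `g`.
  have hex : ∀ σ : Signs n, ∃ h : H, (⨆ h : H, corr σ (fun i => smoothed act μ h (x i)))
      < corr σ (fun i => smoothed act μ h (x i)) + η / 2 ^ n := by
    intro σ
    obtain ⟨h, hh⟩ := exists_lt_of_lt_ciSup
      (sub_lt_self (⨆ h : H, corr σ (fun i => smoothed act μ h (x i)))
        (show 0 < η / 2 ^ n by positivity))
    exact ⟨h, by linarith⟩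
  choose k hk using hex
  have hcorr : ∀ σ : Signs n, corr σ (fun i => smoothed act μ (k σ) (x i))
      = ∫ g, corr σ (fun i => ((k σ : X → Label) (act g (x i))).toReal) ∂μ := by
    intro σ
    simp only [corr, smoothed]
    rw [integral_finsetSum _ fun i _ =>
      (integrable_toReal_act (hm _ (k σ).2 (x i))).const_mul _]
    simp only [integral_const_mul]
  have hint : ∀ σ : Signs n,
      Integrable (fun g => corr σ (fun i => ((k σ : X → Label) (act g (x i))).toReal)) μ :=
    fun σ => integrable_finsetSum _ fun i _ =>
      (integrable_toReal_act (hm _ (k σ).2 (x i))).const_mul _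
  have hpt : ∀ g, ∑ σ, corr σ (fun i => ((k σ : X → Label) (act g (x i))).toReal)
      ≤ 2 ^ n * (d * (1 + Real.log (n / d)) / t + n * t / 2) := by
    intro g
    refine le_trans (Finset.sum_le_sum fun σ _ => ?_)
      (sum_iSup_corr_le_of_card_patterns (fun (h : H) i => (h : X → Label) (act g (x i)))
        (patterns H fun i => act g (x i)) (fun h => mem_patterns _ h.2)
        (card_patterns_le_exp hd hdn _) ht)
    exact le_ciSup (f := fun h : H => corr σ fun i => ((h : X → Label) (act g (x i))).toReal)
      (bddAbove_range_corr σ (M := 1) fun h i => (Label.abs_toReal _).le) (k σ)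
  calc ∑ σ, ⨆ h : H, corr σ (fun i => smoothed act μ h (x i))
      ≤ ∑ σ : Signs n, (corr σ (fun i => smoothed act μ (k σ) (x i)) + η / 2 ^ n) :=
        Finset.sum_le_sum fun σ _ => (hk σ).le
    _ = (∫ g, ∑ σ, corr σ (fun i => ((k σ : X → Label) (act g (x i))).toReal) ∂μ) + η := by
        rw [Finset.sum_add_distrib, integral_finsetSum _ fun σ _ => hint σ]
        simp only [hcorr]
        congr 1
        have hcard : (Fintype.card (Signs n) : ℝ) = 2 ^ n := by exact_mod_cast card_signs n
        simp only [Finset.sum_const, Finset.card_univ, nsmul_eq_mul, hcard]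
        field_simp
    _ ≤ _ := by
        gcongr
        calc _ ≤ ∫ _g, 2 ^ n * (d * (1 + Real.log (n / d)) / t + n * t / 2) ∂μ :=
              integral_mono (integrable_finsetSum _ fun σ _ => hint σ) (integrable_const _) hpt
          _ = _ := by simp

end Smoothed

/-! ### Rademacher average and concentration for the loss class -/

section Loss

variable {X G : Type*} [MeasurableSpace G] {act : G → X → X} {μ : Measure G}
  {L : NNReal} {ℓ : ℝ → ℝ}

lemma abs_robustLoss_le [IsProbabilityMeasure μ] (hℓ : LipschitzOnWith L ℓ (Set.Icc (-1) 1))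
    (h : X → Label) (z : X × Label) : |robustLoss ℓ act μ h z| ≤ |ℓ 0| + L := by
  have hv := mul_smoothed_mem_Icc (act := act) (μ := μ) h z
  have h0 := hℓ.dist_le_mul _ hv 0 (by norm_num)
  rw [Real.dist_eq, Real.dist_eq, sub_zero] at h0
  have h1 : (L : ℝ) * |z.2.toReal * smoothed act μ h z.1| ≤ L * 1 :=
    mul_le_mul_of_nonneg_left (abs_le.2 hv) L.2
  have h2 := abs_sub_abs_le_abs_sub (robustLoss ℓ act μ h z) (ℓ 0)
  unfold robustLoss at *
  linarith

lemma isBounded_image_Icc (hℓ : LipschitzOnWith L ℓ (Set.Icc (-1) 1)) :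
    Bornology.IsBounded (ℓ '' Set.Icc (-1) 1) :=
  (isCompact_Icc.image_of_continuousOn hℓ.continuousOn).isBounded

lemma abs_robustLoss_sub_le [IsProbabilityMeasure μ] (hℓ : LipschitzOnWith L ℓ (Set.Icc (-1) 1))
    (h : X → Label) (z z' : X × Label) :
    |robustLoss ℓ act μ h z - robustLoss ℓ act μ h z'| ≤ lossRange ℓ :=
  Metric.dist_le_diam_of_mem (isBounded_image_Icc hℓ)
    (Set.mem_image_of_mem ℓ (mul_smoothed_mem_Icc h z))
    (Set.mem_image_of_mem ℓ (mul_smoothed_mem_Icc h z'))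

lemma lossRange_le (hℓ : LipschitzOnWith L ℓ (Set.Icc (-1) 1)) : lossRange ℓ ≤ 2 * L := by
  refine Metric.diam_le_of_forall_dist_le (by positivity) ?_
  rintro _ ⟨v, hv, rfl⟩ _ ⟨w, hw, rfl⟩
  refine (hℓ.dist_le_mul v hv w hw).trans ?_
  rw [mul_comm]
  gcongr
  rw [Real.dist_eq, abs_le]
  constructor <;> linarith [hv.1, hv.2, hw.1, hw.2]

/-- The Rademacher average of the loss class. -/
lemma sum_iSup_corr_robustLoss_le [IsProbabilityMeasure μ]
    (hℓ : LipschitzOnWith L ℓ (Set.Icc (-1) 1)) {H : Set (X → Label)} (hne : H.Nonempty)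
    (hm : ∀ h ∈ H, ∀ x, Measurable fun g => h (act g x)) {d : ℕ} (hd : vcDim H = d) {n : ℕ}
    (hdn : d ≤ n) {t : ℝ} (ht : 0 < t) (z : Fin n → X × Label) :
    ∑ σ, ⨆ h : H, corr σ (fun i => robustLoss ℓ act μ h (z i))
      ≤ L * (2 ^ n * (d * (1 + Real.log (n / d)) / t + n * t / 2)) := by
  have : Nonempty H := hne.to_subtype
  refine (sum_iSup_corr_le_of_contraction (M := |ℓ 0| + L) _
    (fun (h : H) i => L * smoothed act μ h (z i).1)
    (fun h i => abs_robustLoss_le hℓ _ _) (fun h i => ?_) (fun h h' i => ?_)).trans ?_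
  · rw [abs_mul, abs_of_nonneg (show (0 : ℝ) ≤ L from L.2)]
    have := mul_le_mul_of_nonneg_left (abs_smoothed_le (act := act) (μ := μ) h (z i).1) L.2
    simp only [NNReal.val_eq_coe] at *
    linarith [abs_nonneg (ℓ 0)]
  · have := hℓ.dist_le_mul _ (mul_smoothed_mem_Icc (act := act) (μ := μ) h (z i)) _
      (mul_smoothed_mem_Icc (act := act) (μ := μ) h' (z i))
    rw [Real.dist_eq, Real.dist_eq, ← mul_sub, abs_mul, Label.abs_toReal, one_mul] at this
    rw [← mul_sub, abs_mul, abs_of_nonneg (show (0 : ℝ) ≤ L from L.2)]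
    exact this
  · have hlin : ∀ σ : Signs n, (⨆ h : H, corr σ fun i => L * smoothed act μ h (z i).1)
        = L * ⨆ h : H, corr σ fun i => smoothed act μ h (z i).1 := by
      intro σ
      rw [Real.mul_iSup_of_nonneg (show (0 : ℝ) ≤ L from L.2)]
      congr 1; ext h
      simp only [corr, Finset.mul_sum]
      exact Finset.sum_congr rfl fun i _ => by ring
    simp only [hlin]
    rw [← Finset.mul_sum]
    gcongr
    exact sum_iSup_corr_smoothed_le hne hm hd hdn ht _

open Classical in
/-- For most sign vectors the symmetrised empirical process is uniformly small. -/
lemma card_signs_exists_lt_abs_corr_le [IsProbabilityMeasure μ]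
    (hℓ : LipschitzOnWith L ℓ (Set.Icc (-1) 1)) {H : Set (X → Label)} (hne : H.Nonempty)
    (hm : ∀ h ∈ H, ∀ x, Measurable fun g => h (act g x)) {d : ℕ} (hd : vcDim H = d) {n : ℕ}
    (hdn : d ≤ n) {t s : ℝ} (ht : 0 < t) (hs : 0 ≤ s) (u : ℝ) (z z' : Fin n → X × Label) :
    ((Finset.univ.filter fun σ : Signs n => ∃ h ∈ H,
      u < |corr σ fun i => robustLoss ℓ act μ h (z i) - robustLoss ℓ act μ h (z' i)|).card : ℝ)
      ≤ 2 * (2 ^ n * Real.exp (s * (2 * L * (d * (1 + Real.log (n / d)) / t + n * t / 2) - u)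
        + n * (s * (2 * lossRange ℓ)) ^ 2 / 8)) := by
  have : Nonempty H := hne.to_subtype
  set K := (d * (1 + Real.log (n / d)) / t + n * t / 2)
  set f : H → X × Label → ℝ := fun h => robustLoss ℓ act μ h with hf
  set V : Signs n → ℝ := fun σ => ⨆ h : H, corr σ fun i => f h (z i) - f h (z' i)
  have hB : ∀ (h : H) i, |f h (z i) - f h (z' i)| ≤ lossRange ℓ := fun h i =>
    abs_robustLoss_sub_le hℓ _ _ _
  have hbdd : ∀ σ, BddAbove (Set.range fun h : H => corr σ fun i => f h (z i) - f h (z' i)) :=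
    fun σ => bddAbove_range_corr σ hB
  -- Changing one sign changes its value by at most `2`, and it multiplies a loss difference of size
  -- at most `lossRange ℓ`.
  have hbd : ∀ σ i r, V (Function.update σ i r) - V σ ≤ 2 * lossRange ℓ := by
    intro σ i r
    rw [sub_le_iff_le_add]
    refine ciSup_le fun h => ?_
    rw [corr_update]
    have h1 := le_ciSup (hbdd σ) h
    have h2 : (r.toReal - (σ i).toReal) * (f h (z i) - f h (z' i)) ≤ 2 * lossRange ℓ := by
      refine (le_abs_self _).trans ?_
      rw [abs_mul]
      refine mul_le_mul ?_ (hB h i) (abs_nonneg _) (by norm_num)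
      refine (abs_sub _ _).trans ?_
      rw [Label.abs_toReal, Label.abs_toReal]; norm_num
    linarith
  have hmean : ∑ σ, V σ ≤ 2 ^ n * (2 * L * K) := by
    have hz := sum_iSup_corr_robustLoss_le (act := act) (μ := μ) hℓ hne hm hd hdn ht z
    have hz' := sum_iSup_corr_robustLoss_le (act := act) (μ := μ) hℓ hne hm hd hdn ht z'
    -- The second sample enters with a minus sign, which negating the sign vector absorbs.
    rw [← Equiv.sum_comp (Equiv.neg (Signs n))] at hz'
    have hb : ∀ (w : Fin n → X × Label) (σ : Signs n),
        BddAbove (Set.range fun h : H => corr σ fun i => f h (w i)) := fun w σ =>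
      bddAbove_range_corr σ fun h i => abs_robustLoss_le hℓ _ _
    calc ∑ σ, V σ ≤ ∑ σ : Signs n, ((⨆ h : H, corr σ fun i => f h (z i))
          + ⨆ h : H, corr (-σ) fun i => f h (z' i)) := by
          refine Finset.sum_le_sum fun σ _ => ciSup_le fun h => ?_
          have h1 := le_ciSup (hb z σ) h
          have h2 := le_ciSup (hb z' (-σ)) h
          rw [corr_neg] at h2
          rw [corr_sub]
          linarith
      _ ≤ _ := by
          rw [Finset.sum_add_distrib]
          simp only [Equiv.neg_apply] at hz'
          exact (add_le_add hz hz').trans_eq (by ring)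
  have hcard := card_signs_le_of_bounded_differences V hbd hs hmean u
  set E := Finset.univ.filter fun σ => u < V σ
  refine le_trans ?_ (mul_le_mul_of_nonneg_left hcard zero_le_two)
  -- A lower deviation at `σ` is an upper deviation at `-σ`; hence the factor `2`.
  have hsub : (Finset.univ.filter fun σ : Signs n => ∃ h ∈ H,
      u < |corr σ fun i => robustLoss ℓ act μ h (z i) - robustLoss ℓ act μ h (z' i)|)
      ⊆ E ∪ E.image fun σ => -σ := by
    intro σ hσ
    obtain ⟨h, hh, hu⟩ := (Finset.mem_filter.1 hσ).2
    rw [Finset.mem_union]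
    rcases lt_abs.1 hu with h1 | h1
    · left
      exact Finset.mem_filter.2 ⟨Finset.mem_univ _, h1.trans_le (le_ciSup (hbdd σ) ⟨h, hh⟩)⟩
    · right
      rw [← corr_neg] at h1
      exact Finset.mem_image.2 ⟨-σ, Finset.mem_filter.2
        ⟨Finset.mem_univ _, h1.trans_le (le_ciSup (hbdd (-σ)) ⟨h, hh⟩)⟩, neg_neg σ⟩
  have := (Finset.card_le_card hsub).trans (Finset.card_union_le _ _)
  have h2 : (E.image fun σ => -σ).card ≤ E.card := Finset.card_image_le
  have h3 : (Finset.univ.filter fun σ : Signs n => ∃ h ∈ H,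
      u < |corr σ fun i => robustLoss ℓ act μ h (z i) - robustLoss ℓ act μ h (z' i)|).card
      ≤ 2 * E.card := by omega
  exact_mod_cast h3

end Loss

/-! ### Symmetrisation -/

section Symmetrisation

variable {Z : Type*} [MeasurableSpace Z] {D : Measure Z} [IsProbabilityMeasure D] {F : Set (Z → ℝ)}

lemma IsMeasurableClass.aemeasurable_iSup (hF : IsMeasurableClass D F) {ι : Type*} [Fintype ι]
    (e : ι → ℝ) :
    AEMeasurable (fun z : ι → Z => ⨆ f : F, |∑ i, e i * (f : Z → ℝ) (z i)|)
      (Measure.pi fun _ => D) := by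
  set q := Fintype.equivFin ι
  have hmp : MeasurePreserving (MeasurableEquiv.piCongrLeft (fun _ => Z) q)
      (Measure.pi fun _ => D) (Measure.pi fun _ => D) :=
    measurePreserving_piCongrLeft (fun _ => D) q
  have h := (hF _ fun j => e (q.symm j)).comp_quasiMeasurePreserving hmp.quasiMeasurePreserving
  refine h.congr (Filter.Eventually.of_forall fun z => ?_)
  simp only [Function.comp_apply]
  congr 1; ext f; congr 1
  rw [← q.sum_comp]
  refine Finset.sum_congr rfl fun i _ => ?_
  rw [Equiv.symm_apply_apply, MeasurableEquiv.coe_piCongrLeft, Equiv.piCongrLeft_apply_apply]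

/-- An i.i.d. law is invariant under permuting coordinates. A permutation is measure-preserving in
both directions, so the event need not be measurable here. -/
lemma measure_exists_lt_abs_sum_comp_perm {ι : Type*} [Fintype ι] (e : ι → ℝ) (π : Equiv.Perm ι)
    (u : ℝ) :
    (Measure.pi fun _ : ι => D) {z | ∃ f ∈ F, u < |∑ i, e (π i) * f (z i)|}
      = (Measure.pi fun _ : ι => D) {z | ∃ f ∈ F, u < |∑ i, e i * f (z i)|} := by
  have hmp : MeasurePreserving (MeasurableEquiv.piCongrLeft (fun _ => Z) π)
      (Measure.pi fun _ => D) (Measure.pi fun _ => D) :=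
    measurePreserving_piCongrLeft (fun _ => D) π
  rw [← hmp.measure_preimage_equiv {z | ∃ f ∈ F, u < |∑ i, e i * f (z i)|}]
  congr 1
  ext z
  simp only [Set.mem_ofPred_eq, Set.mem_preimage]
  refine exists_congr fun f => and_congr_right fun _ => ?_
  rw [← Equiv.sum_comp π fun i => e i * f (MeasurableEquiv.piCongrLeft (fun _ => Z) π z i)]
  simp only [MeasurableEquiv.coe_piCongrLeft, Equiv.piCongrLeft_apply_apply]

/-- The permutation of two samples of size `n` exchanging the `i`-th examples when `σ i = -1`. -/
def swapPerm {n : ℕ} (σ : Signs n) : Equiv.Perm (Fin n ⊕ Fin n) :=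
  Function.Involutive.toPerm
    (Sum.elim (fun i => if σ i = 1 then Sum.inl i else Sum.inr i)
      fun i => if σ i = 1 then Sum.inr i else Sum.inl i)
    (by rintro (i | i) <;> by_cases h : σ i = 1 <;> simp [h])

lemma swapPerm_inl {n : ℕ} (σ : Signs n) (i : Fin n) :
    swapPerm σ (Sum.inl i) = if σ i = 1 then Sum.inl i else Sum.inr i := rfl

lemma swapPerm_inr {n : ℕ} (σ : Signs n) (i : Fin n) :
    swapPerm σ (Sum.inr i) = if σ i = 1 then Sum.inr i else Sum.inl i := rfl

/-- The weights of the difference of two empirical sums, with signs. -/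
noncomputable def diffWeight {n : ℕ} (σ : Signs n) : Fin n ⊕ Fin n → ℝ :=
  Sum.elim (fun i => (σ i).toReal) fun i => -(σ i).toReal

lemma diffWeight_one_swapPerm {n : ℕ} (σ : Signs n) (j : Fin n ⊕ Fin n) :
    diffWeight 1 (swapPerm σ j) = diffWeight σ j := by
  rcases j with i | i <;> rcases Int.units_eq_one_or (σ i) with h | h <;>
    simp [diffWeight, swapPerm_inl, swapPerm_inr, h, Label.toReal_neg, Label.toReal_one]

lemma sum_diffWeight {Z : Type*} {n : ℕ} (σ : Signs n) (f : Z → ℝ) (z : Fin n ⊕ Fin n → Z) :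
    ∑ j, diffWeight σ j * f (z j) = corr σ fun i => f (z (Sum.inl i)) - f (z (Sum.inr i)) := by
  rw [Fintype.sum_sum_type, corr, ← Finset.sum_add_distrib]
  refine Finset.sum_congr rfl fun i _ => ?_
  simp [diffWeight]; ring

/-- The uniform bound makes the supremum a genuine one, so exceeding `u` somewhere in `F` is the
same as the supremum exceeding `u`; `IsMeasurableClass` then applies. This is what permits
interchanging the sum over signs with the integral. -/
lemma nullMeasurableSet_exists_lt_abs_sum (hF : IsMeasurableClass D F) {M : ℝ}
    (hM : ∀ f ∈ F, ∀ z, |f z| ≤ M) {ι : Type*} [Fintype ι] (e : ι → ℝ) {u : ℝ} :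
    NullMeasurableSet {z : ι → Z | ∃ f ∈ F, u < |∑ i, e i * f (z i)|}
      (Measure.pi fun _ : ι => D) := by
  rcases F.eq_empty_or_nonempty with rfl | hne
  · simp
  have : Nonempty F := hne.to_subtype
  have h := nullMeasurableSet_lt (aemeasurable_const (b := u)) (hF.aemeasurable_iSup e)
  convert h using 1
  ext z
  have hb : BddAbove (Set.range fun f : F => |∑ i, e i * (f : Z → ℝ) (z i)|) := by
    refine ⟨∑ i, |e i| * M, ?_⟩
    rintro _ ⟨f, rfl⟩
    refine (Finset.abs_sum_le_sum_abs _ _).trans (Finset.sum_le_sum fun i _ => ?_)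
    rw [abs_mul]
    exact mul_le_mul_of_nonneg_left (hM f f.2 _) (abs_nonneg _)
  simp only [Set.mem_ofPred_eq]
  rw [lt_ciSup_iff hb]
  simp

open Classical in
/-- Random exchanges of the examples of two samples reduce the two-sample deviation to a count
of sign vectors. -/
lemma prod_exists_lt_abs_sum_sub_le (hF : IsMeasurableClass D F) {M : ℝ}
    (hM : ∀ f ∈ F, ∀ z, |f z| ≤ M) {n : ℕ} {u q : ℝ}
    (hq : ∀ z z' : Fin n → Z, ((Finset.univ.filter fun σ : Signs n =>
      ∃ f ∈ F, u < |corr σ fun i => f (z i) - f (z' i)|).card : ℝ) ≤ 2 ^ n * q) :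
    ((sampleLaw D n).prod (sampleLaw D n))
      {p | ∃ f ∈ F, u < |(∑ i, f (p.1 i)) - ∑ i, f (p.2 i)|} ≤ ENNReal.ofReal q := by
  set ν : Measure (Fin n ⊕ Fin n → Z) := Measure.pi fun _ => D
  set E : Signs n → Set (Fin n ⊕ Fin n → Z) := fun σ =>
    {z | ∃ f ∈ F, u < |∑ j, diffWeight σ j * f (z j)|} with hE
  have hmp := measurePreserving_sumPiEquivProdPi (X := fun _ : Fin n ⊕ Fin n => Z) (fun _ => D)
  have h1 : ((sampleLaw D n).prod (sampleLaw D n))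
      {p | ∃ f ∈ F, u < |(∑ i, f (p.1 i)) - ∑ i, f (p.2 i)|} = ν (E 1) := by
    unfold sampleLaw
    rw [← hmp.measure_preimage_equiv]
    congr 1
    ext z
    simp only [hE, Set.mem_ofPred_eq, Set.mem_preimage, sum_diffWeight, corr_sub]
    simp [corr, Label.toReal_one, MeasurableEquiv.sumPiEquivProdPi, Equiv.sumPiEquivProdPi]
  have h2 : ∀ σ, ν (E 1) = ν (E σ) := by
    intro σ
    rw [← measure_exists_lt_abs_sum_comp_perm (diffWeight 1) (swapPerm σ)]
    simp only [diffWeight_one_swapPerm, hE, ν]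
  have hnull : ∀ σ, NullMeasurableSet (E σ) ν := fun σ =>
    nullMeasurableSet_exists_lt_abs_sum hF hM _
  have h3 : (2 ^ n : ENNReal) * ν (E 1) ≤ 2 ^ n * ENNReal.ofReal q := by
    calc (2 ^ n : ENNReal) * ν (E 1) = ∑ σ : Signs n, ν (E σ) := by
          simp only [← h2, Finset.sum_const, Finset.card_univ, card_signs, nsmul_eq_mul]
          push_cast; rfl
      _ = ∑ σ : Signs n, ∫⁻ z, (E σ).indicator 1 z ∂ν :=
          Finset.sum_congr rfl fun σ _ => (lintegral_indicator_one₀ (hnull σ)).symm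
      _ = ∫⁻ z, ∑ σ : Signs n, (E σ).indicator 1 z ∂ν :=
          (lintegral_finsetSum' _ fun σ _ => aemeasurable_one.indicator₀ (hnull σ)).symm
      _ ≤ ∫⁻ _z, 2 ^ n * ENNReal.ofReal q ∂ν := by
          refine lintegral_mono fun z => ?_
          have hc := hq (fun i => z (Sum.inl i)) fun i => z (Sum.inr i)
          have hs : ∑ σ : Signs n, (E σ).indicator (1 : (Fin n ⊕ Fin n → Z) → ENNReal) z
              = ((Finset.univ.filter fun σ : Signs n => ∃ f ∈ F,
                u < |corr σ fun i => f (z (Sum.inl i)) - f (z (Sum.inr i))|).card : ENNReal) := by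
            simp only [Set.indicator_apply, hE, Set.mem_ofPred_eq, sum_diffWeight, Pi.one_apply]
            rw [Finset.sum_boole]
          rw [hs]
          calc _ = ENNReal.ofReal ((Finset.univ.filter fun σ : Signs n => ∃ f ∈ F,
                u < |corr σ fun i => f (z (Sum.inl i)) - f (z (Sum.inr i))|).card : ℝ) := by
                rw [ENNReal.ofReal_natCast]
            _ ≤ ENNReal.ofReal (2 ^ n * q) := ENNReal.ofReal_le_ofReal hc
            _ = _ := by
                rw [ENNReal.ofReal_mul (by positivity), ENNReal.ofReal_pow zero_le_two]
                simp
      _ = 2 ^ n * ENNReal.ofReal q := by simp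
  rw [h1]
  exact (ENNReal.mul_le_mul_iff_right (by positivity) (by finiteness)).1 h3

/-- **Chebyshev's inequality** for an empirical sum. -/
lemma sampleLaw_abs_sum_sub_ge_le {f : Z → ℝ} (hf : Measurable f) {B : ℝ}
    (hB : ∀ z z', |f z - f z'| ≤ B) {n : ℕ} (hn : 1 ≤ n) {ε : ℝ} (hε : 0 < ε)
    (hnε : 8 * B ^ 2 ≤ n * ε ^ 2) :
    sampleLaw D n {S | n * (ε / 2) ≤ |∑ i, f (S i) - n * ∫ z, f z ∂D|} ≤ 1 / 2 := by
  obtain ⟨z₀⟩ : Nonempty Z := nonempty_of_isProbabilityMeasure D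
  have hn0 : (0 : ℝ) < n := by exact_mod_cast hn
  have hIcc : ∀ z, f z ∈ Set.Icc (f z₀ - B) (f z₀ + B) := fun z => by
    have := abs_le.1 (hB z z₀)
    constructor <;> linarith
  have hL : MemLp f 2 D := memLp_of_bounded (Filter.Eventually.of_forall hIcc)
    hf.aestronglyMeasurable 2
  have hvar : ProbabilityTheory.variance f D ≤ B ^ 2 := by
    refine (ProbabilityTheory.variance_le_sq_of_bounded (Filter.Eventually.of_forall hIcc)
      hf.aemeasurable).trans_eq ?_
    ring
  have hsumvar := ProbabilityTheory.variance_sum_pi (μ := fun _ : Fin n => D)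
    (X := fun _ => f) fun _ => hL
  have hLi : ∀ i : Fin n, MemLp (fun S : Fin n → Z => f (S i)) 2 (Measure.pi fun _ => D) :=
    fun i => hL.comp_measurePreserving (measurePreserving_eval (fun _ : Fin n => D) i)
  have hLs : MemLp (∑ i, fun S : Fin n → Z => f (S i)) 2 (Measure.pi fun _ => D) :=
    memLp_finsetSum' _ fun i _ => hLi i
  have hmean : ∫ S, (∑ i, fun S : Fin n → Z => f (S i)) S ∂(Measure.pi fun _ => D)
      = n * ∫ z, f z ∂D := by
    simp only [Finset.sum_apply]
    rw [integral_finsetSum _ fun i _ => (hLi i).integrable (by norm_num)]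
    have : ∀ i : Fin n, ∫ S : Fin n → Z, f (S i) ∂(Measure.pi fun _ => D) = ∫ z, f z ∂D :=
      fun i => integral_comp_eval (μ := fun _ : Fin n => D) hf.aestronglyMeasurable
    simp [this]
  -- The bound is `n * B ^ 2 / (n * ε / 2) ^ 2 = 4 * B ^ 2 / (n * ε ^ 2)`, at most `1 / 2` by `hnε`.
  have h := ProbabilityTheory.meas_ge_le_variance_div_sq hLs (c := n * (ε / 2)) (by positivity)
  rw [hmean, hsumvar] at h
  simp only [Finset.sum_apply] at h
  refine h.trans ?_
  rw [show (1 / 2 : ENNReal) = ENNReal.ofReal (1 / 2) by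
    rw [ENNReal.ofReal_div_of_pos zero_lt_two]; simp]
  refine ENNReal.ofReal_le_ofReal ?_
  rw [div_le_iff₀ (by positivity)]
  simp only [Finset.sum_const, Finset.card_univ, Fintype.card_fin, nsmul_eq_mul]
  nlinarith [mul_le_mul_of_nonneg_left hvar hn0.le, mul_le_mul_of_nonneg_left hnε hn0.le]

/-- **Symmetrisation by a ghost sample**, for the outer measure of the deviation event. -/
lemma sampleLaw_exists_lt_abs_le {B : ℝ} (hFm : ∀ f ∈ F, Measurable f)
    (hB : ∀ f ∈ F, ∀ z z', |f z - f z'| ≤ B) {n : ℕ} (hn : 1 ≤ n) {ε : ℝ} (hε : 0 < ε)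
    (hnε : 8 * B ^ 2 ≤ n * ε ^ 2) :
    sampleLaw D n {S | ∃ f ∈ F, ε < |∫ z, f z ∂D - (∑ i, f (S i)) / n|}
      ≤ 2 * ((sampleLaw D n).prod (sampleLaw D n))
        {p | ∃ f ∈ F, n * (ε / 2) < |(∑ i, f (p.1 i)) - ∑ i, f (p.2 i)|} := by
  have : IsProbabilityMeasure (sampleLaw D n) := by unfold sampleLaw; infer_instance
  have hn0 : (0 : ℝ) < n := by exact_mod_cast hn
  set P := sampleLaw D n
  set E : Set ((Fin n → Z) × (Fin n → Z)) :=
    {p | ∃ f ∈ F, n * (ε / 2) < |(∑ i, f (p.1 i)) - ∑ i, f (p.2 i)|} with hE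
  -- Passing to a measurable hull gives Tonelli and Markov a measurable set without changing the
  -- measure of `E`.
  set E' := toMeasurable (P.prod P) E
  have hE' : MeasurableSet E' := measurableSet_toMeasurable _ _
  have hsub : {S | ∃ f ∈ F, ε < |∫ z, f z ∂D - (∑ i, f (S i)) / n|}
      ⊆ {S | 1 / 2 ≤ P (Prod.mk S ⁻¹' E')} := by
    rintro S ⟨f, hf, hS⟩
    -- The offending `f` depends on `S` only, so for the ghost sample Chebyshev's inequality for
    -- this single function suffices.
    set bad : Set (Fin n → Z) := {S | n * (ε / 2) ≤ |∑ i, f (S i) - n * ∫ z, f z ∂D|} with hbad_def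
    have hbad : P bad ≤ 1 / 2 := sampleLaw_abs_sum_sub_ge_le (hFm f hf) (hB f hf) hn hε hnε
    have hgood : badᶜ ⊆ Prod.mk S ⁻¹' E' := by
      intro S' hS'
      refine subset_toMeasurable _ _ ⟨f, hf, ?_⟩
      simp only [hbad_def, Set.mem_compl_iff, Set.mem_ofPred_eq, not_le] at hS'
      have h1 : n * ε < |n * ∫ z, f z ∂D - ∑ i, f (S i)| := by
        have : n * ∫ z, f z ∂D - ∑ i, f (S i) = n * (∫ z, f z ∂D - (∑ i, f (S i)) / n) := by
          field_simp
        rw [this, abs_mul, abs_of_pos hn0]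
        exact mul_lt_mul_of_pos_left hS hn0
      have h2 := abs_sub_le (∑ i, f (S i)) (∑ i, f (S' i)) (n * ∫ z, f z ∂D)
      rw [abs_sub_comm] at h1
      dsimp only
      linarith
    have h1 : (1 : ENNReal) ≤ P bad + P badᶜ := by
      rw [← measure_univ (μ := P), ← Set.union_compl_self bad]
      exact measure_union_le _ _
    have h2 : (1 / 2 : ENNReal) + 1 / 2 ≤ 1 / 2 + P badᶜ := by
      rw [ENNReal.add_halves]
      exact h1.trans (by gcongr)
    exact ((ENNReal.add_le_add_iff_left (by finiteness)).1 h2).trans (measure_mono hgood)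
  have hmarkov := mul_meas_ge_le_lintegral (μ := P) (measurable_measure_prodMk_left (ν := P) hE')
    (1 / 2)
  rw [← Measure.prod_apply hE', measure_toMeasurable] at hmarkov
  calc _ ≤ P {S | 1 / 2 ≤ P (Prod.mk S ⁻¹' E')} := measure_mono hsub
    _ = 2 * (1 / 2 * P {S | 1 / 2 ≤ P (Prod.mk S ⁻¹' E')}) := by
        rw [← mul_assoc, ENNReal.mul_div_cancel (by norm_num) (by norm_num), one_mul]
    _ ≤ _ := by gcongr

end Symmetrisation

/-! ### Sample-size arithmetic -/

lemma one_le_logOne (t : ℝ) : 1 ≤ logOne t := le_max_left _ _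

lemma logOne_two_mul_le (t : ℝ) : logOne (2 * t) ≤ 2 * logOne t := by
  have h1 := one_le_logOne t
  refine max_le (by linarith) ?_
  rcases eq_or_ne t 0 with rfl | ht
  · simp; linarith
  · rw [Real.log_mul two_ne_zero ht]
    have h2 : Real.log t ≤ logOne t := le_max_right _ _
    linarith [Real.log_two_lt_d9]

/-- Halving `ε` multiplies `1 / ε ^ 2` by `4` and at most doubles the logarithm. -/
lemma sampleBound_half_le (d : ℕ) {L B ε δ : ℝ} (hε : 0 < ε) :
    sampleBound d L B (ε / 2) δ ≤ 8 * sampleBound d L B ε δ := by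
  have h1 : L / (ε / 2) = 2 * (L / ε) := by field_simp
  have h2 := logOne_two_mul_le (L / ε)
  have h3 : (0 : ℝ) ≤ d * L ^ 2 := by positivity
  have h4 : 0 ≤ B ^ 2 * logOne (1 / δ) :=
    mul_nonneg (sq_nonneg _) (zero_le_one.trans (one_le_logOne _))
  unfold sampleBound
  rw [h1]
  have h5 : d * L ^ 2 * logOne (2 * (L / ε)) + B ^ 2 * logOne (1 / δ)
      ≤ 2 * (d * L ^ 2 * logOne (L / ε) + B ^ 2 * logOne (1 / δ)) := by
    nlinarith [mul_le_mul_of_nonneg_left h2 h3]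
  calc _ ≤ 2 * (d * L ^ 2 * logOne (L / ε) + B ^ 2 * logOne (1 / δ)) / (ε / 2) ^ 2 := by gcongr
    _ = _ := by field_simp; norm_num; ring

/-- The growth exponent contains `log (n / d)`, whereas the sample size involves only `log (L / ε)`.
With `x = n / d` and `r = L / ε`, the implicit inequality is resolved by `log x ≤ x / A - 1 + log A`
at `A = 4096 * r ^ 2 * M`, whose logarithm is controlled by `M`. -/
lemma mul_growth_exponent_le {d n : ℕ} {L ε : ℝ} (hε : 0 < ε) (hL : ε ≤ 2 * L)
    (h : 4096 * (d * L ^ 2 * logOne (L / ε)) ≤ n * ε ^ 2) :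
    d ≤ n ∧ 128 * L ^ 2 * (d * (1 + Real.log (n / d))) ≤ n * ε ^ 2 := by
  rcases Nat.eq_zero_or_pos d with rfl | hd
  · simp; positivity
  have hd0 : (0 : ℝ) < d := by exact_mod_cast hd
  have hL0 : 0 < L := by linarith
  set r := L / ε with hr
  set M := logOne r
  have hM1 : 1 ≤ M := one_le_logOne _
  have hMr : Real.log r ≤ M := le_max_right _ _
  have hr0 : 0 < r := by positivity
  have hr2 : 1 / 2 ≤ r := by rw [hr, le_div_iff₀ hε]; linarith
  have hLr : L = r * ε := by rw [hr]; field_simp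
  set x : ℝ := n / d with hx
  have hnx : (n : ℝ) = x * d := by rw [hx]; field_simp
  have hxM : 4096 * (r ^ 2 * M) ≤ x := by
    rw [hnx, hLr] at h
    have : d * ε ^ 2 * (4096 * (r ^ 2 * M)) ≤ d * ε ^ 2 * x := by linarith
    exact le_of_mul_le_mul_left this (by positivity)
  have hrM : 1 / 4 ≤ r ^ 2 * M := by nlinarith
  have hx0 : 0 < x := by linarith
  constructor
  · have : (d : ℝ) ≤ n := by rw [hnx]; nlinarith
    exact_mod_cast this
  · have hlog : Real.log x ≤ x / (4096 * (r ^ 2 * M)) + 3 * M + 6.4 := by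
      have e : x = x / (4096 * (r ^ 2 * M)) * (2 ^ 12 * (r ^ 2 * M)) := by
        norm_num; field_simp
      have h1 := Real.log_le_sub_one_of_pos (x := x / (4096 * (r ^ 2 * M))) (by positivity)
      have h2 := Real.log_le_sub_one_of_pos (x := M) (by linarith)
      have h3 : Real.log x = Real.log (x / (4096 * (r ^ 2 * M)))
          + (12 * Real.log 2 + (2 * Real.log r + Real.log M)) := by
        conv_lhs => rw [e]
        rw [Real.log_mul (by positivity) (by positivity), Real.log_mul (by positivity)
          (by positivity), Real.log_mul (by positivity) (by positivity), Real.log_pow, Real.log_pow]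
        norm_num
      linarith [Real.log_two_lt_d9]
    have hmul : r ^ 2 * (x / (4096 * (r ^ 2 * M))) ≤ x / 4096 := by
      have : r ^ 2 * (x / (4096 * (r ^ 2 * M))) = x / 4096 / M := by field_simp
      rw [this]
      exact div_le_self (by positivity) hM1
    have hr2M : r ^ 2 ≤ r ^ 2 * M := le_mul_of_one_le_right (sq_nonneg _) hM1
    have key : 128 * r ^ 2 * (1 + Real.log x) ≤ x := by
      have h4 := mul_le_mul_of_nonneg_left hlog (sq_nonneg r)
      linarith
    rw [hLr, hnx]
    have := mul_le_mul_of_nonneg_left key (show 0 ≤ d * ε ^ 2 by positivity)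
    linarith

lemma four_mul_exp_le {δ y : ℝ} (hδ : 0 < δ) (hy : 4 * logOne (1 / δ) ≤ y) :
    4 * Real.exp (-y) ≤ δ := by
  have h1 := one_le_logOne (1 / δ)
  have h2 : Real.log (1 / δ) ≤ logOne (1 / δ) := le_max_right _ _
  have h3 : -y ≤ -(2 * Real.log 2) + Real.log δ := by
    rw [one_div, Real.log_inv] at h2
    rw [one_div] at *
    linarith [Real.log_two_lt_d9]
  calc 4 * Real.exp (-y) ≤ 4 * Real.exp (-(2 * Real.log 2) + Real.log δ) := by gcongr
    _ = δ := by
        rw [Real.exp_add, Real.exp_log hδ, Real.exp_neg, ← Real.log_rpow two_pos,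
          Real.exp_log (by positivity)]
        norm_num
        ring

/-- Disposes of the case where the range of the loss is at most `ε`: no deviation above `ε` is then
possible. -/
lemma abs_integral_sub_mean_le {Z : Type*} [MeasurableSpace Z] {D : Measure Z}
    [IsProbabilityMeasure D] {f : Z → ℝ} (hf : Integrable f D) {B : ℝ}
    (hB : ∀ z z', |f z - f z'| ≤ B) {n : ℕ} (hn : 1 ≤ n) (S : Fin n → Z) :
    |∫ z, f z ∂D - (∑ i, f (S i)) / n| ≤ B := by
  have hn0 : (0 : ℝ) < n := by exact_mod_cast hn
  have hi : ∀ i, |∫ z, f z ∂D - f (S i)| ≤ B := by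
    intro i
    have h := norm_integral_le_of_norm_le_const (μ := D) (f := fun z => f z - f (S i))
      (Filter.Eventually.of_forall fun z => hB z (S i))
    rw [integral_sub hf (integrable_const _)] at h
    simpa using h
  have e : ∫ z, f z ∂D - (∑ i, f (S i)) / n = (∑ i, (∫ z, f z ∂D - f (S i))) / n := by
    rw [Finset.sum_sub_distrib]
    simp
    field_simp
  rw [e, abs_div, abs_of_pos hn0, div_le_iff₀ hn0]
  calc _ ≤ ∑ i, |∫ z, f z ∂D - f (S i)| := Finset.abs_sum_le_sum_abs _ _
    _ ≤ ∑ _i : Fin n, B := Finset.sum_le_sum fun i _ => hi i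
    _ = B * n := by simp [mul_comm]

/-! ### Uniform convergence and ERM -/

section Main

variable {X G : Type*} [MeasurableSpace X] [MeasurableSpace G] {act : G → X → X} {μ : Measure G}
  {L : NNReal} {ℓ : ℝ → ℝ}

lemma measurable_robustLoss [IsProbabilityMeasure μ] (hℓ : LipschitzOnWith L ℓ (Set.Icc (-1) 1))
    {h : X → Label} (hm : Measurable fun p : G × X => h (act p.1 p.2)) :
    Measurable (robustLoss ℓ act μ h) := by
  have h1 : Measurable (smoothed act μ h) :=
    (Label.measurable_toReal.comp hm).stronglyMeasurable.integral_prod_left'.measurable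
  have hv : Measurable fun z : X × Label => z.2.toReal * smoothed act μ h z.1 :=
    (Label.measurable_toReal.comp measurable_snd).mul (h1.comp measurable_fst)
  -- `ℓ` is controlled only on `[-1, 1]`; the margins stay there, so it may be replaced by its
  -- continuous extension.
  have hext : Continuous (Set.IccExtend (by norm_num : (-1 : ℝ) ≤ 1) ((Set.Icc (-1) 1).domRestrict ℓ)) :=
    hℓ.continuousOn.domRestrict.Icc_extend'
  convert hext.measurable.comp hv using 1
  ext z
  simp only [Function.comp_apply]
  rw [Set.IccExtend_of_mem _ _ (mul_smoothed_mem_Icc h z)]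
  rfl

/-- Uniform convergence of the empirical risks for the smoothed loss. -/
theorem sampleLaw_exists_lt_abs_risk_sub_empRisk_le [IsProbabilityMeasure μ]
    (hℓ : LipschitzOnWith L ℓ (Set.Icc (-1) 1)) {H : Set (X → Label)}
    (hH : ∀ h ∈ H, Measurable fun p : G × X => h (act p.1 p.2)) {d : ℕ} (hd : vcDim H = d)
    {ε δ : ℝ} (hε : 0 < ε) (hδ : 0 < δ) {n : ℕ} (hn : 1 ≤ n)
    (hbound : 4096 * sampleBound d L (lossRange ℓ) ε δ ≤ n)
    (D : Measure (X × Label)) [IsProbabilityMeasure D]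
    (hF : IsMeasurableClass D (robustLoss ℓ act μ '' H)) :
    sampleLaw D n {S | ∃ h ∈ H,
      ε < |risk (robustLoss ℓ act μ) D h - empRisk (robustLoss ℓ act μ) S h|}
        ≤ ENNReal.ofReal δ := by
  classical
  set B := lossRange ℓ with hB_def
  have hn0 : (0 : ℝ) < n := by exact_mod_cast hn
  have hFm : ∀ f ∈ robustLoss ℓ act μ '' H, Measurable f := by
    rintro _ ⟨h, hh, rfl⟩; exact measurable_robustLoss hℓ (hH h hh)
  have hFB : ∀ f ∈ robustLoss ℓ act μ '' H, ∀ z z', |f z - f z'| ≤ B := by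
    rintro _ ⟨h, hh, rfl⟩; exact abs_robustLoss_sub_le hℓ h
  have hFM : ∀ f ∈ robustLoss ℓ act μ '' H, ∀ z, |f z| ≤ |ℓ 0| + L := by
    rintro _ ⟨h, hh, rfl⟩; exact abs_robustLoss_le hℓ h
  have hset : {S : Fin n → X × Label | ∃ h ∈ H,
      ε < |risk (robustLoss ℓ act μ) D h - empRisk (robustLoss ℓ act μ) S h|}
      = {S | ∃ f ∈ robustLoss ℓ act μ '' H, ε < |∫ z, f z ∂D - (∑ i, f (S i)) / n|} := by
    ext S; simp [risk, empRisk]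
  rw [hset]
  rcases le_or_gt B ε with hBε | hBε
  · have : {S : Fin n → X × Label | ∃ f ∈ robustLoss ℓ act μ '' H,
        ε < |∫ z, f z ∂D - (∑ i, f (S i)) / n|} = ∅ := by
      refine Set.eq_empty_of_forall_notMem ?_
      rintro S ⟨f, hf, hS⟩
      have hint : Integrable f D := Integrable.of_bound (hFm f hf).aestronglyMeasurable _
        (Filter.Eventually.of_forall (hFM f hf))
      linarith [abs_integral_sub_mean_le hint (hFB f hf) hn S]
    rw [this]; simp
  rcases H.eq_empty_or_nonempty with rfl | hne
  · simp
  have hB0 : 0 < B := hε.trans hBε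
  have hBL : B ≤ 2 * L := lossRange_le hℓ
  have hL0 : (0 : ℝ) < L := by linarith
  have hl1 := one_le_logOne (1 / δ)
  have hl2 := one_le_logOne (L / ε)
  have hsum : 4096 * (d * (L : ℝ) ^ 2 * logOne (L / ε)) + 4096 * (B ^ 2 * logOne (1 / δ))
      ≤ n * ε ^ 2 := by
    unfold sampleBound at hbound
    rw [mul_div_assoc', div_le_iff₀ (by positivity)] at hbound
    linarith
  have hp1 : 0 ≤ d * (L : ℝ) ^ 2 * logOne (L / ε) := by positivity
  have hp2 : B ^ 2 ≤ B ^ 2 * logOne (1 / δ) := le_mul_of_one_le_right (sq_nonneg _) hl1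
  have hB2 : 0 < B ^ 2 := by positivity
  obtain ⟨hdn, hgrowth⟩ := mul_growth_exponent_le (d := d) (n := n) hε (by linarith)
    (show 4096 * (d * (L : ℝ) ^ 2 * logOne (L / ε)) ≤ n * ε ^ 2 by linarith)
  set K : ℝ := d * (1 + Real.log (n / d))
  -- This `t` makes each of the two Massart terms at most `n * ε / 8`, so the mean is at most half
  -- the threshold `n * ε / 2`. The next choice, `s`, minimises the resulting exponent `-s * n * ε /
  -- 4 + n * s ^ 2 * B ^ 2 / 2`.
  set t := ε / (8 * L) with ht
  set s := ε / (4 * B ^ 2) with hs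
  set q := 2 * Real.exp (s * (2 * L * (K / t + n * t / 2) - n * (ε / 2))
    + n * (s * (2 * B)) ^ 2 / 8) with hq
  have hsections : ∀ h ∈ H, ∀ x, Measurable fun g => h (act g x) := fun h hh x =>
    (hH h hh).comp measurable_prodMk_right
  have hcount := fun z z' : Fin n → X × Label =>
    card_signs_exists_lt_abs_corr_le (act := act) (μ := μ) hℓ hne hsections hd hdn
      (show 0 < t by positivity) (show 0 ≤ s by positivity) (n * (ε / 2)) z z'
  have hprod := prod_exists_lt_abs_sum_sub_le (D := D) hF hFM (n := n) (u := n * (ε / 2)) (q := q)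
    fun z z' => by
      refine le_trans (le_of_eq ?_) ((hcount z z').trans_eq (by rw [hq]; ring))
      congr 2
      ext σ
      simp
  refine (sampleLaw_exists_lt_abs_le hFm hFB hn hε (by linarith)).trans ?_
  refine (mul_le_mul_right hprod 2).trans ?_
  rw [show (2 : ENNReal) = ENNReal.ofReal 2 by simp, ← ENNReal.ofReal_mul zero_le_two]
  refine ENNReal.ofReal_le_ofReal ?_
  have hmean : 2 * L * (K / t + n * t / 2) ≤ n * (ε / 4) := by
    have e : 2 * L * (K / t + n * t / 2) = (128 * L ^ 2 * K) / (8 * ε) + n * (ε / 8) := by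
      rw [ht]; field_simp; ring
    have : (128 * L ^ 2 * K) / (8 * ε) ≤ n * (ε / 8) := by
      rw [div_le_iff₀ (by positivity)]
      linarith
    rw [e]; linarith
  have hexp : s * (2 * L * (K / t + n * t / 2) - n * (ε / 2)) + n * (s * (2 * B)) ^ 2 / 8
      ≤ -(n * ε ^ 2 / (32 * B ^ 2)) := by
    calc _ ≤ s * (n * (ε / 4) - n * (ε / 2)) + n * (s * (2 * B)) ^ 2 / 8 := by gcongr
      _ = _ := by rw [hs]; field_simp; ring
  have hy : 4 * logOne (1 / δ) ≤ n * ε ^ 2 / (32 * B ^ 2) := by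
    rw [le_div_iff₀ (by positivity)]
    linarith
  calc 2 * q = 4 * Real.exp (s * (2 * L * (K / t + n * t / 2) - n * (ε / 2))
        + n * (s * (2 * B)) ^ 2 / 8) := by rw [hq]; ring
    _ ≤ 4 * Real.exp (-(n * ε ^ 2 / (32 * B ^ 2))) := by gcongr
    _ ≤ δ := four_mul_exp_le hδ hy

end Main

end RobustLearning

theorem theorem2 :
    ∃ C : ℝ, 0 < C ∧
      ∀ (X : Type*) [MeasurableSpace X]
        -- the adversary
        (G : Type*) [MeasurableSpace G] (act : G → X → X) (μ : Measure G) [IsProbabilityMeasure μ]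
        -- the loss
        (L : NNReal) (ℓ : ℝ → ℝ) (_ : LipschitzOnWith L ℓ (Set.Icc (-1) 1))
        -- the hypothesis class
        (H : Set (X → Label)) (_ : ∀ h ∈ H, Measurable fun p : G × X => h (act p.1 p.2))
        (d : ℕ) (_ : vcDim H = d)
        (ε δ : ℝ) (_ : ε ∈ Set.Ioo (0 : ℝ) 1) (_ : δ ∈ Set.Ioo (0 : ℝ) 1)
        (n : ℕ) (_ : 1 ≤ n) (_ : C * sampleBound d L (lossRange ℓ) ε δ ≤ n),
        -- uniform convergence
        (∀ (D : Measure (X × Label)) [IsProbabilityMeasure D],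
          IsMeasurableClass D (robustLoss ℓ act μ '' H) →
          sampleLaw D n {S | ¬ ∀ h ∈ H,
            |risk (robustLoss ℓ act μ) D h - empRisk (robustLoss ℓ act μ) S h| ≤ ε}
              ≤ ENNReal.ofReal δ) ∧
        -- empirical risk minimisation is a proper agnostic learner
        (∀ (γ : ℝ) (_ : 0 ≤ γ) (A : (m : ℕ) → (Fin m → X × Label) → (X → Label)),
          IsERM (robustLoss ℓ act μ) H γ A →
          ∀ (D : Measure (X × Label)) [IsProbabilityMeasure D],
          IsMeasurableClass D (robustLoss ℓ act μ '' H) →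
          sampleLaw D n {S | ¬ risk (robustLoss ℓ act μ) D (A n S)
            ≤ (⨅ h : H, risk (robustLoss ℓ act μ) D h) + ε + γ}
              ≤ ENNReal.ofReal δ) := by
  -- `32768 = 8 * 4096`: the factor `8` pays for running uniform convergence at `ε / 2` in the ERM
  -- part.
  refine ⟨32768, by norm_num, ?_⟩
  intro X _ G _ act μ _ L ℓ hℓ H hH d hd ε δ hε hδ n hn hbound
  have hlog1 := one_le_logOne (L / ε)
  have hlog2 := one_le_logOne (1 / δ)
  have hpos : 0 ≤ sampleBound d L (lossRange ℓ) ε δ := by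
    unfold sampleBound
    positivity
  refine ⟨fun D _ hF => ?_, fun γ hγ A hA D _ hF => ?_⟩
  · refine (measure_mono fun S hS => ?_).trans
      (sampleLaw_exists_lt_abs_risk_sub_empRisk_le hℓ hH hd hε.1 hδ.1 hn (by linarith) D hF)
    simpa using hS
  · have hhalf := sampleBound_half_le d (L := L) (B := lossRange ℓ) (δ := δ) hε.1
    refine (measure_mono fun S hS => ?_).trans
      (sampleLaw_exists_lt_abs_risk_sub_empRisk_le hℓ hH hd (half_pos hε.1) hδ.1 hn
        (by linarith) D hF)
    by_contra hcon
    simp only [Set.mem_ofPred_eq, not_exists, not_and, not_lt] at hcon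
    refine hS ?_
    obtain ⟨hAH, hAmin⟩ := hA n S
    have : Nonempty H := ⟨⟨_, hAH⟩⟩
    have hinf : risk (robustLoss ℓ act μ) D (A n S) - ε - γ
        ≤ ⨅ h : H, risk (robustLoss ℓ act μ) D h := by
      refine le_ciInf fun h => ?_
      have h1 := (abs_le.1 (hcon _ hAH)).2
      have h2 := (abs_le.1 (hcon _ h.2)).1
      have h3 := hAmin h h.2
      linarith
    linarith
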